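/- Let $\mathcal A$ be a unital $C^*$-algebra, $U$ a (left) Hilbert $\mathcal A$-module with inner product $\langle\cdot,\cdot\rangle$ that is $\mathcal A$-linear in the first variable, and $(\Omega,\mu)$ a measure space. All integrals of $\mathcal A$-valued functions are Bochner integrals, and measurability of $\mathcal A$-valued functions is meant in the sense of Bochner. Let $L^2(\Omega,\mathcal A)$ be the $\mathcal A$-module of ($\mu$-a.e. classes of) measurable functions $\varphi:\Omega\to\mathcal A$ for which $\int_\Omega|\varphi(\omega)^*|^2\,d\mu(\omega)=\int_\Omega\varphi(\omega)\varphi(\omega)^*\,d\mu(\omega)$ exists, with $\langle\varphi,\psi\rangle=\int_\Omega\varphi(\omega)\psi(\omega)^*\,d\mu(\omega)$ and $\|\varphi\|=\|\langle\varphi,\varphi\rangle\|^{1/2}$. A map $F:\Omega\to U$ is *weakly measurable* if $\omega\mapsto\langle f,F(\omega)\rangle$ is measurable for every $f\in U$. It is *Bessel* if it is weakly measurable and there is $B'>0$ such that for every $f\in U$ the integral $\int_\Omega\langle f,F(\omega)\rangle\langle F(\omega),f\rangle\,d\mu(\omega)$ exists and is at most $B'\langle f,f\rangle$. It is *$\mu$-complete*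 if it is Bessel and $\{f\in U:\langle f,F(\omega)\rangle=0\ \text{for }\mu\text{-a.e. }\omega\}=\{0\}$. For measurable $E\subseteq\Omega$ and $\varphi\in L^2(\Omega,\mathcal A)$, the weak integral $\int_E\varphi F\,d\mu$ is the $u\in U$ (if it exists) with $\langle u,f\rangle=\int_E\varphi(\omega)\langle F(\omega),f\rangle\,d\mu(\omega)$ for all $f\in U$. The map $F$ is a *continuous Riesz basis with bounds $A,B>0$* if it is weakly measurable and $\mu$-complete and, for every $\varphi\in L^2(\Omega,\mathcal A)$ and every measurable $\Omega_1\subseteq\Omega$ with $\mu(\Omega_1)<\infty$, the weak integral $\int_{\Omega_1}\varphi F\,d\mu$ exists and $$A\,\Big\|\int_{\Omega_1}|\varphi^*|^2\,d\mu\Big\|\le\Big\|\int_{\Omega_1}\varphi F\,d\mu\Big\|^2\le B\,\Big\|\int_{\Omega_1}|\varphi^*|^2\,d\mu\Big\| .$$ **Corollary.** Let $F:\Omega\to U$ be a continuous Riesz basis with bounds $A,B>0$. Then $F$ is $\mu$-complete. The pre-frame operator $T:L^2(\Omega,\mathcal A)\to U$, $T\varphi=\int_\Omega\varphi F\,d\mu$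 (weak integral), is well defined and bounded, and it has the bounded adjoint $T^*:U\to L^2(\Omega,\mathcal A)$, $(T^*f)(\omega)=\langle f,F(\omega)\rangle$. The mapping $$V:L^2(\Omega,\mathcal A)\to L^2(\Omega,\mathcal A),\qquad V\varphi=\int_\Omega\varphi(\omega)\,\langle F(\omega),F(\cdot)\rangle\,d\mu(\omega),$$ is well defined, equals $T^*T$, is bounded and adjointable, and is invertible with a bounded adjointable inverse; moreover $$\|(T^*T)^{-1}\|^{-1}\langle\varphi,\varphi\rangle\le\langle V\varphi,\varphi\rangle\le B\,\langle\varphi,\varphi\rangle\qquad(\varphi\in L^2(\Omega,\mathcal A)).$$ -/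

import Mathlib

open MeasureTheory

noncomputable section

/-! Hilbert `A`-modules are Mathlib's `CStarModule`s, which are left modules here. Mathlib's inner
product is `A`-linear in the second variable, so the `A`-valued inner product `⟨f, g⟩` that is
`A`-linear in the first variable is `inner A g f`. All integrals are Bochner integrals. -/

namespace HilbertModule

/-- Square-integrability of an `A`-valued function is the existence of the Bochner integral of
`|φ(ω)^*|² = φ(ω) φ(ω)^*`. -/
theorem memLp_two_iff_integrable_mul_star {Ω A : Type*} [MeasurableSpace Ω] {μ : Measure Ω}
    [CStarAlgebra A] {φ : Ω → A} (hφ : AEStronglyMeasurable φ μ) :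
    MemLp φ 2 μ ↔ Integrable (fun ω => φ ω * star (φ ω)) μ := by
  have h : AEStronglyMeasurable (fun ω => φ ω * star (φ ω)) μ :=
    hφ.mul (continuous_star.comp_aestronglyMeasurable hφ)
  rw [memLp_two_iff_integrable_sq_norm hφ, ← integrable_norm_iff h]
  simp only [CStarRing.norm_self_mul_star, sq]

/-- `L²(Ω, A)`: the almost-everywhere classes of strongly measurable `φ : Ω → A` for which
`φ φ^*` is Bochner integrable. It is a type of its own because its norm is the Hilbert-module norm
`‖∫ φ φ^*‖^{1/2}`, not the norm `(∫ ‖φ‖²)^{1/2}` of `Lp A 2 μ`. -/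
def L2 {Ω : Type*} [MeasurableSpace Ω] (A : Type*) [CStarAlgebra A] (μ : Measure Ω) : Type _ :=
  Lp A 2 μ

section L2

variable {Ω : Type*} [MeasurableSpace Ω] {A : Type*} [CStarAlgebra A] {μ : Measure Ω}

instance : AddCommGroup (L2 A μ) := inferInstanceAs (AddCommGroup (Lp A 2 μ))
instance : Module ℂ (L2 A μ) := inferInstanceAs (Module ℂ (Lp A 2 μ))
instance : Module A (L2 A μ) := inferInstanceAs (Module A (Lp A 2 μ))

/-- The underlying class of functions. -/
def L2.toLp (φ : L2 A μ) : Lp A 2 μ := φ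

/-- A representative of a class in `L²(Ω, A)`. -/
instance : CoeFun (L2 A μ) (fun _ => Ω → A) := ⟨fun φ => L2.toLp φ⟩

/-- `⟨φ, ψ⟩ = ∫ φ(ω) ψ(ω)^* dμ(ω)`; this is `inner A ψ φ`. -/
instance : Inner A (L2 A μ) := ⟨fun ψ φ => ∫ ω, φ ω * star (ψ ω) ∂μ⟩

/-- `‖φ‖ = ‖⟨φ, φ⟩‖^{1/2}`. -/
instance : Norm (L2 A μ) := ⟨fun φ => √‖(inner A φ φ : A)‖⟩

theorem L2.inner_def (ψ φ : L2 A μ) : inner A ψ φ = ∫ ω, φ ω * star (ψ ω) ∂μ := rfl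

theorem L2.norm_def (φ : L2 A μ) : ‖φ‖ = √‖∫ ω, φ ω * star (φ ω) ∂μ‖ := rfl

theorem L2.memLp (φ : L2 A μ) : MemLp (φ : Ω → A) 2 μ := Lp.memLp φ.toLp

theorem L2.integrable_mul_star (φ ψ : L2 A μ) : Integrable (fun ω => φ ω * star (ψ ω)) μ :=
  (L2.memLp φ).integrable_mul (L2.memLp ψ).star

theorem L2.coeFn_add (φ ψ : L2 A μ) : (φ + ψ : L2 A μ) =ᵐ[μ] fun ω => φ ω + ψ ω :=
  Lp.coeFn_add φ.toLp ψ.toLp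

theorem L2.coeFn_smul_complex (z : ℂ) (φ : L2 A μ) : (z • φ : L2 A μ) =ᵐ[μ] fun ω => z • φ ω :=
  Lp.coeFn_smul z φ.toLp

theorem L2.coeFn_smul (a : A) (φ : L2 A μ) : (a • φ : L2 A μ) =ᵐ[μ] fun ω => a * φ ω :=
  Lp.coeFn_smul a φ.toLp

variable [PartialOrder A] [StarOrderedRing A]

instance : CStarModule A (L2 A μ) where
  inner_add_right {x y z} := by
    rw [L2.inner_def, L2.inner_def, L2.inner_def,
      ← integral_add (L2.integrable_mul_star y x) (L2.integrable_mul_star z x)]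
    refine integral_congr_ae ?_
    filter_upwards [L2.coeFn_add y z] with ω h
    rw [h, add_mul]
  inner_self_nonneg {x} := by
    rw [L2.inner_def]
    exact integral_nonneg fun ω => mul_star_self_nonneg _
  inner_self {x} := by
    rw [L2.inner_def]
    constructor
    · intro h
      have h0 := (L2.integrable_mul_star x x).ae_eq_zero_of_forall_setIntegral_eq_zero
        fun s hs _ => by
          have h1 : ∀ t : Set Ω, 0 ≤ ∫ ω in t, x ω * star (x ω) ∂μ := fun t =>
            integral_nonneg fun ω => mul_star_self_nonneg _
          have h2 := integral_add_compl hs (L2.integrable_mul_star x x)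
          rw [h] at h2
          exact ((add_eq_zero_iff_of_nonneg (h1 s) (h1 sᶜ)).1 h2).1
      refine (Lp.eq_zero_iff_ae_eq_zero (f := x.toLp)).2 ?_
      filter_upwards [h0] with ω hω
      exact (CStarRing.mul_star_self_eq_zero_iff _).1 hω
    · rintro rfl
      have h0 : ((0 : L2 A μ) : Ω → A) =ᵐ[μ] 0 := Lp.coeFn_zero A 2 μ
      refine integral_eq_zero_of_ae ?_
      filter_upwards [h0] with ω hω
      simp [hω]
  inner_op_smul_right {a x y} := by
    rw [L2.inner_def, L2.inner_def, ← integral_const_mul_of_integrable (L2.integrable_mul_star y x)]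
    refine integral_congr_ae ?_
    filter_upwards [L2.coeFn_smul a y] with ω h
    rw [h, mul_assoc]
  inner_smul_right_complex {z x y} := by
    rw [L2.inner_def, L2.inner_def, ← integral_smul]
    refine integral_congr_ae ?_
    filter_upwards [L2.coeFn_smul_complex z y] with ω h
    rw [h, smul_mul_assoc]
  star_inner x y := by
    rw [L2.inner_def, L2.inner_def]
    have h := ((starL' ℝ : A ≃L[ℝ] A) : A →L[ℝ] A).integral_comp_comm (L2.integrable_mul_star y x)
    simpa using h.symm
  norm_eq_sqrt_norm_inner_self x := rfl

instance : NormedAddCommGroup (L2 A μ) := CStarModule.normedAddCommGroup A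

instance : NormedSpace ℂ (L2 A μ) := NormedSpace.ofCore (CStarModule.normedSpaceCore A)

end L2

section Adjoint

variable (A : Type*) {U W : Type*} [Inner A U] [Inner A W]

/-- `S` is the adjoint of `T`: `⟨T f, g⟩ = ⟨f, S g⟩` for all `f`, `g`. -/
def IsAdjoint (T : U → W) (S : W → U) : Prop :=
  ∀ f g, inner A g (T f) = inner A (S g) f

/-- `T` has an adjoint. -/
def IsAdjointable (T : U → W) : Prop :=
  ∃ S : W → U, IsAdjoint A T S

end Adjoint

section Frames

variable {Ω : Type*} [MeasurableSpace Ω] (A : Type*) [CStarAlgebra A] [PartialOrder A]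
  [StarOrderedRing A] {U : Type*} [NormedAddCommGroup U] [NormedSpace ℂ U] [Module A U]
  [CStarModule A U] (μ : Measure Ω) (F : Ω → U)

/-- For every `f`, the function `ω ↦ ⟨f, F ω⟩` is measurable in the sense of Bochner. -/
def IsWeaklyMeasurable : Prop :=
  ∀ f : U, AEStronglyMeasurable (fun ω => inner A (F ω) f) μ

/-- `F` is Bessel: it is weakly measurable, and for some `B > 0` and all `f`, the integral
`∫ ⟨f, F ω⟩ ⟨F ω, f⟩ dμ(ω)` exists and is at most `B ⟨f, f⟩`. -/
def IsBessel : Prop :=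
  IsWeaklyMeasurable A μ F ∧ ∃ B : ℝ, 0 < B ∧ ∀ f : U,
    Integrable (fun ω => inner A (F ω) f * inner A f (F ω)) μ ∧
    ∫ ω, inner A (F ω) f * inner A f (F ω) ∂μ ≤ B • inner A f f

/-- `F` is a `μ`-complete (Bessel) mapping. -/
def IsMuComplete : Prop :=
  IsBessel A μ F ∧ {f : U | ∀ᵐ ω ∂μ, inner A (F ω) f = 0} = {0}

/-- `u = ∫_E φ(ω) F(ω) dμ(ω)` in the weak sense: `⟨u, f⟩ = ∫_E φ(ω) ⟨F ω, f⟩ dμ(ω)` for all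
`f`, where the integrals on the right exist. Such a `u` is unique. -/
def IsWeakIntegral (E : Set Ω) (φ : Ω → A) (u : U) : Prop :=
  ∀ f : U, IntegrableOn (fun ω => φ ω * inner A f (F ω)) E μ ∧
    inner A f u = ∫ ω in E, φ ω * inner A f (F ω) ∂μ

/-- `F` is a continuous Riesz basis with bounds `a, b > 0`. -/
structure IsContinuousRieszBasis (a b : ℝ) : Prop where
  weaklyMeasurable : IsWeaklyMeasurable A μ F
  muComplete : IsMuComplete A μ F
  lower_pos : 0 < a
  upper_pos : 0 < b
  bounds : ∀ (φ : L2 A μ) (E : Set Ω), MeasurableSet E → μ E < ⊤ →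
    ∃ u : U, IsWeakIntegral A μ F E φ u ∧
      a * ‖∫ ω in E, φ ω * star (φ ω) ∂μ‖ ≤ ‖u‖ ^ 2 ∧
      ‖u‖ ^ 2 ≤ b * ‖∫ ω in E, φ ω * star (φ ω) ∂μ‖

/-- `T : L²(Ω, A) → U` is the pre-frame (synthesis) operator of `F`:
`⟨T φ, f⟩ = ∫ φ(ω) ⟨F ω, f⟩ dμ(ω)`. -/
def IsPreFrameOperator (T : L2 A μ → U) : Prop :=
  ∀ φ : L2 A μ, IsWeakIntegral A μ F Set.univ φ (T φ)

/-- `S : U → L²(Ω, A)` is the analysis operator of `F`: `(S f)(ω) = ⟨f, F ω⟩`. -/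
def IsAnalysisOperator (S : U → L2 A μ) : Prop :=
  ∀ f : U, (S f : Ω → A) =ᵐ[μ] fun ω => inner A (F ω) f

/-- `V : L²(Ω, A) → L²(Ω, A)` is the mapping `φ ↦ ∫ φ(ω) ⟨F ω, F(·)⟩ dμ(ω)`, where the integrals
exist. -/
def IsGramMap (V : L2 A μ → L2 A μ) : Prop :=
  ∀ φ : L2 A μ, (∀ γ : Ω, Integrable (fun ω => φ ω * inner A (F γ) (F ω)) μ) ∧
    (V φ : Ω → A) =ᵐ[μ] fun γ => ∫ ω, φ ω * inner A (F γ) (F ω) ∂μ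

end Frames

end HilbertModule

end

/-! Let `T` be synthesis and `S` analysis, so that `V = S T`. A weak integral over `Ω` is the limit
of weak integrals over sets of finite measure exhausting the support of `φ`. The Riesz bounds pass
to this limit, so `T` is bounded and bounded below. Completeness of `F` makes its adjoint `S`
injective.

The difficulty is that `L2 A μ` need not be complete in its Hilbert-module norm, so the
invertibility of `S T` cannot be read off from the lower bound on `T`. Instead `G = T S` is inverted
on the complete space `U` (`IsAdjoint.isUnit_comp`): `G + t` is invertible for `t > 0`, and
injectivity of `S` bounds the inverses uniformly as `t → 0`. Then `S G⁻² T` inverts `S T`.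

The order inequalities follow from norm inequalities applied to all `d • φ`, because `T` is
`A`-linear and a norm bound on all conjugates gives an order bound
(`le_smul_of_forall_norm_conjugate_le`). -/

namespace HilbertModule

open Filter Topology

/-! ### From norm bounds to order bounds in a C*-algebra. -/

section Order

variable {A : Type*} [CStarAlgebra A] [PartialOrder A] [StarOrderedRing A]

/-- If every conjugate of `p ≥ 0` is bounded in norm by `c` times the conjugate of `q ≥ 0`, then
`p ≤ c • q`. -/
theorem le_smul_of_forall_norm_conjugate_le {p q : A} (hp : 0 ≤ p) (hq : 0 ≤ q) {c : ℝ}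
    (hc : 0 ≤ c) (h : ∀ d : A, ‖d * p * star d‖ ≤ c * ‖d * q * star d‖) : p ≤ c • q := by
  -- Since `q` may fail to be invertible, work with `s = q + ε`. Conjugating by `s ^ (-1/2)` makes
  -- `q` at most `1`, hence `p` at most `c`; conjugating back by `s ^ (1/2)` gives `p ≤ c • s`.
  have key : ∀ ε : ℝ, 0 < ε → p ≤ c • (q + algebraMap ℝ A ε) := by
    intro ε hε
    have h1 : IsStrictlyPositive (algebraMap ℝ A ε) := by
      rw [IsStrictlyPositive.iff_of_unital]
      refine ⟨?_, (IsUnit.mk0 ε hε.ne').map _⟩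
      rw [Algebra.algebraMap_eq_smul_one]
      exact smul_nonneg hε.le zero_le_one
    have hh : IsStrictlyPositive (q + algebraMap ℝ A ε) := h1.nonneg_add hq
    set s : A := q + algebraMap ℝ A ε with hs
    set d : A := s ^ (-(1 / 2) : ℝ) with hd
    set e : A := s ^ (1 / 2 : ℝ) with he
    have hdsa : star d = d := (IsSelfAdjoint.of_nonneg CFC.rpow_nonneg).star_eq
    have hesa : star e = e := (IsSelfAdjoint.of_nonneg CFC.rpow_nonneg).star_eq
    have hdsd : d * s * d = 1 := CFC.conjugate_rpow_neg_one_half s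
    have hed : e * d = 1 := CFC.rpow_mul_rpow_neg (1 / 2) hh
    have hde : d * e = 1 := CFC.rpow_neg_mul_rpow (1 / 2) hh
    have hese : e * e = s := by
      rw [he, ← CFC.rpow_add hh.isUnit]
      norm_num
      exact CFC.rpow_one s hh.nonneg
    have hqs : q ≤ s := by
      rw [hs]; exact le_add_of_nonneg_right h1.nonneg
    have h2 : ‖d * q * star d‖ ≤ 1 := by
      refine (CStarAlgebra.norm_le_one_iff_of_nonneg _ (star_right_conjugate_nonneg hq d)).2 ?_
      calc d * q * star d ≤ d * s * star d := star_right_conjugate_le_conjugate hqs d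
        _ = 1 := by rw [hdsa, hdsd]
    have h3 : d * p * star d ≤ algebraMap ℝ A c :=
      (CStarAlgebra.norm_le_iff_le_algebraMap _ hc (star_right_conjugate_nonneg hp d)).1
        ((h d).trans (by nlinarith))
    calc p = e * (d * p * star d) * star e := by
          rw [hdsa, hesa]
          simp only [← mul_assoc, hed, one_mul]
          rw [mul_assoc, hde, mul_one]
      _ ≤ e * algebraMap ℝ A c * star e := star_right_conjugate_le_conjugate h3 e
      _ = c • s := by
          rw [hesa, ← Algebra.commutes, mul_assoc, hese, Algebra.smul_def]
  have hlim : Tendsto (fun ε : ℝ => c • (q + algebraMap ℝ A ε)) (𝓝[>] 0)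
      (𝓝 (c • (q + algebraMap ℝ A 0))) := by
    refine Tendsto.mono_left (Continuous.tendsto ?_ 0) nhdsWithin_le_nhds
    fun_prop
  have h4 := CStarAlgebra.isClosed_nonneg.mem_of_tendsto (hlim.sub_const p)
    (eventually_nhdsWithin_of_forall fun ε hε => sub_nonneg.2 (key ε hε))
  simpa using h4

variable {X Y : Type*} [NormedAddCommGroup X] [NormedSpace ℂ X] [SMul A X] [CStarModule A X]
  [NormedAddCommGroup Y] [NormedSpace ℂ Y] [SMul A Y] [CStarModule A Y]

/-- Here `‖d • x‖ ^ 2` is the norm of the conjugate of `⟨x, x⟩` by `d`. -/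
theorem inner_self_le_smul_inner_self {x : X} {y : Y} {c : ℝ} (hc : 0 ≤ c)
    (h : ∀ d : A, ‖d • x‖ ^ 2 ≤ c * ‖d • y‖ ^ 2) : inner A x x ≤ c • inner A y y := by
  refine le_smul_of_forall_norm_conjugate_le CStarModule.inner_self_nonneg
    CStarModule.inner_self_nonneg hc fun d => ?_
  simpa [CStarModule.norm_sq_eq A, mul_assoc] using h d

end Order

/-! ### Adjoint pairs and invertibility without completeness of the domain. -/

section Adjoint

variable {A : Type*} [CStarAlgebra A] [PartialOrder A] [StarOrderedRing A]
  {X U : Type*} [NormedAddCommGroup X] [NormedSpace ℂ X] [SMul A X] [CStarModule A X]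
  [NormedAddCommGroup U] [NormedSpace ℂ U] [SMul A U] [CStarModule A U]

omit [StarOrderedRing A] in
variable (A) in
theorem ext_inner {u v : U} (h : ∀ f : U, inner A f u = inner A f v) : u = v := by
  have h1 : inner A (u - v) (u - v) = 0 := by
    rw [CStarModule.inner_sub_right, h, sub_self]
  exact sub_eq_zero.1 (CStarModule.inner_self.1 h1)

omit [StarOrderedRing A] in
theorem IsAdjoint.inner_left {T : X → U} {S : U → X} (h : IsAdjoint A T S) (x : X) (u : U) :
    inner A (T x) u = inner A x (S u) := by
  rw [← CStarModule.star_inner u, h, CStarModule.star_inner]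

-- Having an adjoint forces `A`-linearity, which lets norm bounds on `T` be tested on every `d • x`.
omit [StarOrderedRing A] in
theorem IsAdjoint.map_smul {T : X → U} {S : U → X} (h : IsAdjoint A T S) (d : A) (x : X) :
    T (d • x) = d • T x :=
  ext_inner A fun f => by
    rw [h, CStarModule.inner_op_smul_right, CStarModule.inner_op_smul_right, h]

/-- A positive multiple of the identity added to `S T` preserves a lower bound of `T`. -/
theorem IsAdjoint.mul_norm_le_norm_add_smul {T : X → U} {S : U → X} (h : IsAdjoint A T S)
    {a t : ℝ} (ht : 0 ≤ t) {x : X} (hT : a * ‖x‖ ^ 2 ≤ ‖T x‖ ^ 2 ∨ a * ‖x‖ ^ 2 ≤ t * ‖x‖ ^ 2) :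
    a * ‖x‖ ≤ ‖S (T x) + t • x‖ := by
  have h1 : inner A x (S (T x) + t • x) = inner A (T x) (T x) + t • inner A x x := by
    rw [CStarModule.inner_add_right, CStarModule.inner_smul_right_real, h.inner_left]
  have h2 : (0 : A) ≤ inner A (T x) (T x) := CStarModule.inner_self_nonneg
  have h3 : (0 : A) ≤ t • inner A x x := smul_nonneg ht CStarModule.inner_self_nonneg
  -- The inner product is a sum of two nonnegative elements, so its norm dominates the norm of each;
  -- either summand may supply the bound.
  have h4 : a * ‖x‖ ^ 2 ≤ ‖(inner A x (S (T x) + t • x) : A)‖ := by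
    rw [h1]
    rcases hT with hT | hT
    · rw [CStarModule.norm_sq_eq A (x := T x)] at hT
      exact hT.trans (CStarAlgebra.norm_le_norm_of_nonneg_of_le h2 (le_add_of_nonneg_right h3))
    · refine hT.trans (le_trans (le_of_eq ?_)
        (CStarAlgebra.norm_le_norm_of_nonneg_of_le h3 (le_add_of_nonneg_left h2)))
      rw [norm_smul, CStarModule.norm_sq_eq A, Real.norm_of_nonneg ht]
  have h5 : a * ‖x‖ ^ 2 ≤ ‖x‖ * ‖S (T x) + t • x‖ := h4.trans (CStarModule.norm_inner_le X)
  rcases (norm_nonneg x).eq_or_lt with h0 | h0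
  · rw [← h0, mul_zero]; exact norm_nonneg _
  · refine le_of_mul_le_mul_left ?_ h0
    linarith [h5]

/-- The lower bound gives `‖G⁻¹‖ ≤ c⁻¹`, so `H = G (1 - G⁻¹ (G - H))` is invertible by a Neumann
series. -/
theorem isUnit_of_norm_sub_lt [CompleteSpace U] {G H : U →L[ℂ] U} (hG : IsUnit G) {c : ℝ}
    (hc : ∀ f, c * ‖f‖ ≤ ‖G f‖) (h : ‖G - H‖ < c) : IsUnit H := by
  have hc0 : 0 < c := (norm_nonneg _).trans_lt h
  obtain ⟨u, rfl⟩ := hG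
  have h1 : ‖(↑u⁻¹ : U →L[ℂ] U)‖ ≤ c⁻¹ := by
    refine ContinuousLinearMap.opNorm_le_bound _ (inv_nonneg.2 hc0.le) fun f => ?_
    have h2 := hc ((↑u⁻¹ : U →L[ℂ] U) f)
    rw [← mul_apply_eq_comp, u.mul_inv, one_apply_eq_self] at h2
    rwa [inv_mul_eq_div, le_div_iff₀' hc0]
  have h3 : ‖(↑u⁻¹ : U →L[ℂ] U) * (u - H)‖ < 1 := by
    calc _ ≤ ‖(↑u⁻¹ : U →L[ℂ] U)‖ * ‖(u : U →L[ℂ] U) - H‖ := norm_mul_le _ _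
      _ ≤ c⁻¹ * ‖(u : U →L[ℂ] U) - H‖ := by gcongr
      _ < c⁻¹ * c := by gcongr
      _ = 1 := inv_mul_cancel₀ hc0.ne'
  have h4 := u.isUnit.mul (isUnit_one_sub_of_norm_lt_one h3)
  rwa [mul_sub, mul_one, ← mul_assoc, u.mul_inv, one_mul, sub_sub_cancel] at h4

/-- If `T` has an everywhere defined injective adjoint `S` and is bounded below, then `T S` is
invertible; the domain of `T` need not be complete. -/
theorem IsAdjoint.isUnit_comp [CompleteSpace U] {T : X →L[ℂ] U} {S : U →L[ℂ] X}
    (h : IsAdjoint A T S) {a : ℝ} (ha : 0 < a) (hT : ∀ x, a * ‖x‖ ^ 2 ≤ ‖T x‖ ^ 2)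
    (hS : ∀ f, S f = 0 → f = 0) : IsUnit (T ∘L S) := by
  have hadj : IsAdjoint A S T := fun u x => (h.inner_left x u).symm
  set G : U →L[ℂ] U := T ∘L S with hG
  set Gt : ℝ → U →L[ℂ] U := fun t => G + (t : ℂ) • 1 with hGt
  have hGt_apply : ∀ t f, Gt t f = T (S f) + t • f := fun t f => by simp [hGt, hG]
  have hdist : ∀ s t : ℝ, ‖Gt t - Gt s‖ ≤ |t - s| := fun s t => by
    refine ContinuousLinearMap.opNorm_le_bound _ (abs_nonneg _) fun f => ?_
    have : (Gt t - Gt s) f = (t - s) • f := by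
      rw [sub_apply, hGt_apply, hGt_apply, sub_smul]; abel
    rw [this, norm_smul, Real.norm_eq_abs]
  have hlower : ∀ t : ℝ, 0 ≤ t → ∀ f, t * ‖f‖ ≤ ‖Gt t f‖ := fun t ht f => by
    rw [hGt_apply]
    exact hadj.mul_norm_le_norm_add_smul ht (Or.inr le_rfl)
  -- The start exceeds `‖G‖`, so `t 0 • 1` dominates `G`. Each halving moves by `t n / 2`, less than
  -- the lower bound `t n` of `Gt (t n)`, so invertibility persists.
  set t : ℕ → ℝ := fun n => (‖G‖ + 1) / 2 ^ n with ht
  have ht0 : ∀ n, 0 < t n := fun n => by positivity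
  have hunit : ∀ n, IsUnit (Gt (t n)) := by
    intro n
    induction n with
    | zero =>
      have h1 : t 0 = ‖G‖ + 1 := by simp [ht]
      have h2 : IsUnit (((t 0 : ℝ) : ℂ) • (1 : U →L[ℂ] U)) :=
        (isUnit_one).smul (Units.mk0 ((t 0 : ℝ) : ℂ) (by exact_mod_cast (ht0 0).ne'))
      refine isUnit_of_norm_sub_lt h2 (c := t 0) (fun f => ?_) ?_
      · simp [norm_smul, abs_of_pos (ht0 0)]
      · simp only [hGt, sub_add_cancel_right, norm_neg, h1]
        linarith
    | succ n ih =>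
      refine isUnit_of_norm_sub_lt ih (hlower _ (ht0 n).le) ((hdist _ _).trans_lt ?_)
      have h1 : t (n + 1) = t n / 2 := by simp only [ht, pow_succ]; field_simp
      rw [h1, abs_of_pos (by linarith [ht0 n])]
      linarith [ht0 n]
  have htlim : Tendsto t atTop (𝓝 0) := by
    have := (tendsto_pow_atTop_nhds_zero_of_lt_one (r := (1 / 2 : ℝ)) (by norm_num)
      (by norm_num)).const_mul (‖G‖ + 1)
    simpa [ht, div_eq_mul_inv] using this
  -- Since `S (G + s) = (S T + s) S` and `S T + s` is bounded below by `a`, this bound does not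
  -- depend on `s`.
  have hSg : ∀ s : ℝ, 0 ≤ s → ∀ g, ‖S g‖ ≤ a⁻¹ * (‖S‖ * ‖Gt s g‖) := by
    intro s hs g
    have h1 : a * ‖S g‖ ≤ ‖S (Gt s g)‖ := by
      rw [hGt_apply, map_add, ContinuousLinearMap.map_smul_of_tower]
      exact h.mul_norm_le_norm_add_smul hs (Or.inl (hT _))
    rw [inv_mul_eq_div, le_div_iff₀' ha]
    exact h1.trans (S.le_opNorm _)
  set C : ℝ := ‖T‖ * (a⁻¹ * (a⁻¹ * ‖S‖)) with hC
  have hC0 : 0 ≤ C := by positivity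
  -- The difference equals `T S (g' - g)`, and applying `S` gives `(S T + r) S (g' - g) = (r - s) •
  -- S g'`; the lower bound `a` is used here and again in `hSg`.
  have hdiff : ∀ r s : ℝ, 0 ≤ r → 0 ≤ s → ∀ g g', Gt r g = Gt s g' →
      ‖r • g - s • g'‖ ≤ C * |r - s| * ‖Gt s g'‖ := by
    intro r s hr hs g g' hgg
    have h1 : r • g - s • g' = T (S (g' - g)) := by
      rw [hGt_apply, hGt_apply] at hgg
      rw [map_sub, map_sub, sub_eq_sub_iff_add_eq_add, add_comm, hgg, add_comm]
    have h2 : S (T (S (g' - g))) + r • S (g' - g) = (r - s) • S g' := by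
      rw [← h1, ← ContinuousLinearMap.map_smul_of_tower, ← ContinuousLinearMap.map_smul_of_tower,
        ← map_add]
      congr 1
      rw [smul_sub, sub_smul]; abel
    have h3 := h.mul_norm_le_norm_add_smul hr (Or.inl (hT (S (g' - g))))
    rw [h2, norm_smul, Real.norm_eq_abs] at h3
    have h4 : ‖S (g' - g)‖ ≤ a⁻¹ * (|r - s| * ‖S g'‖) := by
      rwa [inv_mul_eq_div, le_div_iff₀' ha]
    rw [h1]
    calc _ ≤ ‖T‖ * ‖S (g' - g)‖ := T.le_opNorm _
      _ ≤ ‖T‖ * (a⁻¹ * (|r - s| * (a⁻¹ * (‖S‖ * ‖Gt s g'‖)))) := by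
          gcongr
          exact h4.trans (by gcongr; exact hSg s hs g')
      _ = _ := by rw [hC]; ring
  -- A lower bound for `Gt (t n)` that does not degenerate as `t n → 0`. With `R k f` a preimage of
  -- `f` under `Gt (t k)`, the vectors `t k • R k f` form a Cauchy sequence by `hdiff`.
  have hbound : ∀ n g, ‖g‖ ≤ C * ‖Gt (t n) g‖ := by
    intro n g
    choose R hR using fun k => (hunit k).exists_right_inv
    set f := Gt (t n) g with hf
    have hRf : ∀ k, Gt (t k) (R k f) = f := fun k => by
      rw [← mul_apply_eq_comp, hR]; rfl
    have hcauchy : CauchySeq fun k => t k • R k f := by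
      rw [Metric.cauchySeq_iff']
      intro ε hε
      have h1 : Tendsto (fun k => C * t k * ‖f‖) atTop (𝓝 0) := by
        simpa using (htlim.const_mul C).mul_const ‖f‖
      obtain ⟨N, hN⟩ := (h1.eventually_lt_const hε).exists
      refine ⟨N, fun k hk => ?_⟩
      rw [dist_eq_norm]
      refine (hdiff _ _ (ht0 k).le (ht0 N).le _ _ ((hRf k).trans (hRf N).symm)).trans_lt
        (lt_of_le_of_lt ?_ hN)
      rw [hRf N]
      have h2 : t k ≤ t N := by
        simp only [ht]
        gcongr
        norm_num
      gcongr
      rw [abs_le]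
      constructor <;> linarith [ht0 k, ht0 N]
    obtain ⟨p, hp⟩ := cauchySeq_tendsto_of_complete hcauchy
    -- By `hSg` the vectors `S (R k f)` stay bounded, so the factor `t k` kills them in the limit;
    -- injectivity of `S` then gives `p = 0`.
    have hSp : S p = 0 := by
      refine tendsto_nhds_unique ((S.continuous.tendsto p).comp hp) ?_
      refine squeeze_zero_norm (a := fun k => t k * (a⁻¹ * (‖S‖ * ‖f‖))) (fun k => ?_) ?_
      · rw [Function.comp, ContinuousLinearMap.map_smul_of_tower, norm_smul,
          Real.norm_of_nonneg (ht0 k).le]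
        have h2 := hSg (t k) (ht0 k).le (R k f)
        rw [hRf] at h2
        exact mul_le_mul_of_nonneg_left h2 (ht0 k).le
      · simpa using htlim.mul_const (a⁻¹ * (‖S‖ * ‖f‖))
    rw [hS p hSp] at hp
    -- Let `k → ∞` in `hdiff`; the factor `t n` then cancels from both sides.
    have h3 : ‖t n • g - 0‖ ≤ C * |t n - 0| * ‖f‖ := by
      refine le_of_tendsto_of_tendsto (tendsto_const_nhds.sub hp).norm
        (((tendsto_const_nhds.sub htlim).abs.const_mul C).mul_const ‖f‖)
        (Eventually.of_forall fun k => ?_)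
      have h4 := hdiff (t n) (t k) (ht0 n).le (ht0 k).le g (R k f) (hRf k).symm
      rwa [hRf] at h4
    rw [sub_zero, sub_zero, norm_smul, Real.norm_of_nonneg (ht0 n).le, abs_of_pos (ht0 n)] at h3
    refine le_of_mul_le_mul_left ?_ (ht0 n)
    linarith
  obtain ⟨n, hn⟩ := (htlim.eventually_lt_const (show 0 < (C + 1)⁻¹ by positivity)).exists
  have h0 : Gt 0 = G := by simp [hGt]
  -- One last perturbation reaches `t = 0`. Using `C + 1` avoids dividing by zero when `C = 0`.
  have := isUnit_of_norm_sub_lt (H := Gt 0) (hunit n) (c := (C + 1)⁻¹) (fun f => ?_)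
    ((hdist _ _).trans_lt (by rwa [sub_zero, abs_of_pos (ht0 n)]))
  · rwa [h0] at this
  · rw [inv_mul_eq_div, div_le_iff₀' (by positivity)]
    exact (hbound n f).trans (by gcongr; linarith)

/-- If `T` has an everywhere defined injective adjoint `S` and is bounded below, then `S T` is
invertible with a bounded inverse. -/
theorem IsAdjoint.exists_equiv [CompleteSpace U] {T : X →L[ℂ] U} {S : U →L[ℂ] X}
    (h : IsAdjoint A T S) {a : ℝ} (ha : 0 < a) (hT : ∀ x, a * ‖x‖ ^ 2 ≤ ‖T x‖ ^ 2)
    (hS : ∀ f, S f = 0 → f = 0) : ∃ V : X ≃L[ℂ] X, ∀ x, V x = S (T x) := by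
  obtain ⟨u, hu⟩ := h.isUnit_comp ha hT hS
  set R : U →L[ℂ] U := ↑u⁻¹ with hR
  have hTSR : ∀ f, T (S (R f)) = f := fun f => by
    have : (u * ↑u⁻¹ : U →L[ℂ] U) f = f := by rw [u.mul_inv]; rfl
    rwa [hu] at this
  have hRTS : ∀ f, R (T (S f)) = f := fun f => by
    have : (↑u⁻¹ * u : U →L[ℂ] U) f = f := by rw [u.inv_mul]; rfl
    rwa [hu] at this
  have hT0 : ∀ x y, T x = T y → x = y := fun x y hxy => by
    have h1 := hT (x - y)
    rw [map_sub, hxy, sub_self, norm_zero, zero_pow two_ne_zero] at h1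
    have h2 : ‖x - y‖ ^ 2 = 0 := le_antisymm (by nlinarith) (sq_nonneg _)
    exact sub_eq_zero.1 (norm_eq_zero.1 (pow_eq_zero_iff two_ne_zero |>.1 h2))
  have hSRT : ∀ x, S (R (T x)) = x := fun x => hT0 _ _ (hTSR _)
  -- With `R = (T S)⁻¹`, the inverse `S R R T` works because `S R T = 1`, by injectivity of `T`.
  refine ⟨ContinuousLinearEquiv.equivOfInverse (S ∘L T) (S ∘L R ∘L R ∘L T) (fun x => ?_)
    (fun x => ?_), fun x => rfl⟩
  · simp [hRTS, hSRT]
  · simp [hTSR, hSRT]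

/-! ### Adjoints and two-sided bounds for `V = S T`. -/

variable {T : X →L[ℂ] U} {S : U →L[ℂ] X} {V : X ≃L[ℂ] X}

omit [StarOrderedRing A] in
theorem IsAdjoint.isAdjoint_equiv (h : IsAdjoint A T S) (hV : ∀ x, V x = S (T x)) :
    IsAdjoint A V V := fun x y => by
  rw [hV, hV, ← h.inner_left, h]

omit [StarOrderedRing A] in
theorem IsAdjoint.isAdjoint_equiv_symm (h : IsAdjoint A T S) (hV : ∀ x, V x = S (T x)) :
    IsAdjoint A V.symm V.symm := fun x y => by
  have := h.isAdjoint_equiv hV (V.symm x) (V.symm y)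
  simpa using this.symm

/-- For `y = V⁻¹ x`, Cauchy–Schwarz applies to `⟨x, x⟩ = ⟨T y, T x⟩` and to `⟨T y, T y⟩ = ⟨x, y⟩`;
combining the two eliminates `T y`. -/
theorem IsAdjoint.norm_sq_le_norm_symm_mul (h : IsAdjoint A T S) (hV : ∀ x, V x = S (T x))
    (x : X) : ‖x‖ ^ 2 ≤ ‖(V.symm : X →L[ℂ] X)‖ * ‖T x‖ ^ 2 := by
  set y := V.symm x with hy
  have hVy : S (T y) = x := by rw [← hV, hy, V.apply_symm_apply]
  have h1 : ‖x‖ ^ 2 ≤ ‖T y‖ * ‖T x‖ := by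
    rw [CStarModule.norm_sq_eq A]
    nth_rw 1 [← hVy]
    rw [← h]
    exact CStarModule.norm_inner_le U
  have h2 : ‖T y‖ ^ 2 ≤ ‖(V.symm : X →L[ℂ] X)‖ * ‖x‖ ^ 2 := by
    rw [CStarModule.norm_sq_eq A, h, hVy]
    calc _ ≤ ‖x‖ * ‖y‖ := CStarModule.norm_inner_le X
      _ ≤ ‖x‖ * (‖(V.symm : X →L[ℂ] X)‖ * ‖x‖) := by
          gcongr; exact (V.symm : X →L[ℂ] X).le_opNorm x
      _ = _ := by ring
  rcases (norm_nonneg x).eq_or_lt with h0 | h0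
  · rw [← h0, zero_pow two_ne_zero]; positivity
  · refine le_of_mul_le_mul_left ?_ (pow_pos h0 2)
    calc ‖x‖ ^ 2 * ‖x‖ ^ 2 ≤ (‖T y‖ * ‖T x‖) * (‖T y‖ * ‖T x‖) := by gcongr
      _ = ‖T y‖ ^ 2 * ‖T x‖ ^ 2 := by ring
      _ ≤ (‖(V.symm : X →L[ℂ] X)‖ * ‖x‖ ^ 2) * ‖T x‖ ^ 2 := by gcongr
      _ = _ := by ring

theorem IsAdjoint.inv_norm_symm_smul_le (h : IsAdjoint A T S) (hV : ∀ x, V x = S (T x)) (x : X) :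
    ‖(V.symm : X →L[ℂ] X)‖⁻¹ • inner A x x ≤ inner A x (V x) := by
  rw [hV, ← h.inner_left]
  have h1 : inner A x x ≤ ‖(V.symm : X →L[ℂ] X)‖ • inner A (T x) (T x) :=
    inner_self_le_smul_inner_self (norm_nonneg _) fun d => by
      rw [← h.map_smul]; exact h.norm_sq_le_norm_symm_mul hV _
  -- If the inverse has norm zero, then `0⁻¹ = 0` and the bound reduces to positivity.
  rcases (norm_nonneg (V.symm : X →L[ℂ] X)).eq_or_lt with h0 | h0
  · rw [← h0, inv_zero, zero_smul]
    exact CStarModule.inner_self_nonneg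
  · calc _ ≤ ‖(V.symm : X →L[ℂ] X)‖⁻¹ • (‖(V.symm : X →L[ℂ] X)‖ • inner A (T x) (T x)) :=
          smul_le_smul_of_nonneg_left h1 (inv_nonneg.2 h0.le)
      _ = _ := by rw [smul_smul, inv_mul_cancel₀ h0.ne', one_smul]

theorem IsAdjoint.inner_map_self_le (h : IsAdjoint A T S) (hV : ∀ x, V x = S (T x)) {b : ℝ}
    (hb : 0 ≤ b) (hT : ∀ x, ‖T x‖ ^ 2 ≤ b * ‖x‖ ^ 2) (x : X) :
    inner A x (V x) ≤ b • inner A x x := by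
  rw [hV, ← h.inner_left]
  exact inner_self_le_smul_inner_self hb fun d => by rw [← h.map_smul]; exact hT _

end Adjoint

/-! ### Synthesis, analysis and Gram operators of a Riesz basis. -/

section Synthesis

variable {Ω : Type*} [MeasurableSpace Ω] {A : Type*} [CStarAlgebra A] [PartialOrder A]
  [StarOrderedRing A] {U : Type*} [NormedAddCommGroup U] [NormedSpace ℂ U] [Module A U]
  [CStarModule A U] {μ : Measure Ω} {F : Ω → U}

theorem L2.norm_sq (φ : L2 A μ) : ‖φ‖ ^ 2 = ‖∫ ω, φ ω * star (φ ω) ∂μ‖ :=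
  CStarModule.norm_sq_eq A

omit [StarOrderedRing A] in
theorem IsBessel.memLp (h : IsBessel A μ F) (f : U) : MemLp (fun ω => inner A (F ω) f) 2 μ := by
  obtain ⟨hm, B, -, hB⟩ := h
  rw [memLp_two_iff_integrable_mul_star (hm f)]
  simpa using (hB f).1

omit [StarOrderedRing A] in
theorem IsBessel.integrable_mul (h : IsBessel A μ F) (φ : L2 A μ) (f : U) :
    Integrable (fun ω => φ ω * inner A f (F ω)) μ := by
  simpa [Pi.mul_def] using (L2.memLp φ).integrable_mul (h.memLp f).star

omit [PartialOrder A] [StarOrderedRing A] in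
/-- An increasing sequence of sets of finite measure outside the union of which `φ` vanishes. -/
theorem L2.exists_monotone_finite (φ : L2 A μ) :
    ∃ E : ℕ → Set Ω, Monotone E ∧ (∀ n, MeasurableSet (E n)) ∧ (∀ n, μ (E n) < ⊤) ∧
      ∀ ω ∉ ⋃ n, E n, φ ω = 0 := by
  have hφ : StronglyMeasurable (φ : Ω → A) := Lp.stronglyMeasurable φ.toLp
  -- Superlevel sets of `‖φ‖` have finite measure by Chebyshev, even if `μ` is not σ-finite.
  refine ⟨fun n => {ω | (1 / (n + 1) : NNReal) ≤ ‖φ ω‖₊}, fun m n hmn ω hω => ?_, fun n => ?_,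
    fun n => (L2.memLp φ).meas_ge_lt_top two_ne_zero ENNReal.ofNat_ne_top (by positivity),
    fun ω hω => ?_⟩
  · refine le_trans ?_ (show (1 / (m + 1) : NNReal) ≤ ‖φ ω‖₊ from hω)
    gcongr
  · exact measurableSet_le measurable_const hφ.nnnorm.measurable
  · by_contra h0
    obtain ⟨n, hn⟩ := exists_nat_one_div_lt (nnnorm_pos.2 h0)
    exact hω (Set.mem_iUnion.2 ⟨n, hn.le⟩)

omit [StarOrderedRing A] in
theorem IsWeakIntegral.diff {φ : Ω → A} {E E' : Set Ω} {u u' v : U}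
    (hu : IsWeakIntegral A μ F E φ u) (hu' : IsWeakIntegral A μ F E' φ u')
    (hv : IsWeakIntegral A μ F (E' \ E) φ v) (hE : MeasurableSet E) (hEE : E ⊆ E') :
    v = u' - u :=
  ext_inner A fun f => by
    rw [CStarModule.inner_sub_right, (hu f).2, (hu' f).2, (hv f).2]
    exact setIntegral_sdiff hE (hu' f).1 hEE

/-- The weak integral of `φ F` over `Ω` exists, with the Riesz bounds. -/
theorem IsContinuousRieszBasis.exists_isWeakIntegral_univ [CompleteSpace U] {a b : ℝ}
    (hF : IsContinuousRieszBasis A μ F a b) (φ : L2 A μ) :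
    ∃ u : U, IsWeakIntegral A μ F Set.univ φ u ∧ a * ‖φ‖ ^ 2 ≤ ‖u‖ ^ 2 ∧
      ‖u‖ ^ 2 ≤ b * ‖φ‖ ^ 2 := by
  obtain ⟨E, hmono, hmeas, hfin, hzero⟩ := L2.exists_monotone_finite φ
  have hint := hF.muComplete.1.integrable_mul φ
  have hlim : ∀ g : Ω → A, Integrable g μ → (∀ ω, φ ω = 0 → g ω = 0) →
      Tendsto (fun n => ∫ ω in E n, g ω ∂μ) atTop (𝓝 (∫ ω, g ω ∂μ)) := fun g hg hg0 => by
    have h1 := tendsto_setIntegral_of_monotone hmeas hmono hg.integrableOn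
    rwa [setIntegral_eq_integral_of_forall_compl_eq_zero fun ω hω => hg0 ω (hzero ω hω)] at h1
  choose u hu hlow hup using fun n => hF.bounds φ (E n) (hmeas n) (hfin n)
  set I : ℕ → A := fun n => ∫ ω in E n, φ ω * star (φ ω) ∂μ with hI
  have hIlim : Tendsto I atTop (𝓝 (∫ ω, φ ω * star (φ ω) ∂μ)) :=
    hlim _ (L2.integrable_mul_star φ φ) fun ω h => by rw [h, zero_mul]
  -- The increment is the weak integral over `E n \ E m`, so the upper Riesz bound controls it by
  -- the integral of `φ φ^*` there.
  have hdiff : ∀ m n, m ≤ n → ‖u n - u m‖ ^ 2 ≤ b * ‖I n - I m‖ := fun m n hmn => by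
    obtain ⟨v, hv, -, hvup⟩ := hF.bounds φ (E n \ E m) ((hmeas n).diff (hmeas m))
      ((measure_mono Set.sdiff_subset).trans_lt (hfin n))
    rw [(hu m).diff (hu n) hv (hmeas m) (hmono hmn)] at hvup
    rwa [setIntegral_sdiff (hmeas m) (L2.integrable_mul_star φ φ).integrableOn (hmono hmn)] at hvup
  have hcauchy : CauchySeq u := by
    rw [Metric.cauchySeq_iff']
    intro ε hε
    obtain ⟨N, hN⟩ := Metric.cauchySeq_iff'.1 hIlim.cauchySeq (ε ^ 2 / b)
      (div_pos (pow_pos hε 2) hF.upper_pos)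
    refine ⟨N, fun n hn => ?_⟩
    have h1 := hN n hn
    rw [dist_eq_norm, lt_div_iff₀' hF.upper_pos] at h1
    rw [dist_eq_norm]
    exact lt_of_pow_lt_pow_left₀ 2 hε.le ((hdiff N n hn).trans_lt h1)
  obtain ⟨w, hw⟩ := cauchySeq_tendsto_of_complete hcauchy
  refine ⟨w, fun f => ⟨(hint f).integrableOn, ?_⟩, ?_, ?_⟩
  · rw [setIntegral_univ]
    have h1 : Tendsto (fun n => inner A f (u n)) atTop (𝓝 (inner A f w)) :=
      ((CStarModule.innerSL (A := A) f).continuous.tendsto w).comp hw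
    refine tendsto_nhds_unique h1 ?_
    simp only [(hu _ f).2]
    exact hlim _ (hint f) fun ω h => by rw [h, zero_mul]
  · rw [L2.norm_sq]
    exact le_of_tendsto_of_tendsto' (hIlim.norm.const_mul a) (hw.norm.pow 2) hlow
  · rw [L2.norm_sq]
    exact le_of_tendsto_of_tendsto' (hw.norm.pow 2) (hIlim.norm.const_mul b) hup

theorem IsContinuousRieszBasis.exists_preFrameOperator [CompleteSpace U] {a b : ℝ}
    (hF : IsContinuousRieszBasis A μ F a b) :
    ∃ T : L2 A μ →L[ℂ] U, IsPreFrameOperator A μ F T ∧ (∀ φ, a * ‖φ‖ ^ 2 ≤ ‖T φ‖ ^ 2) ∧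
      ∀ φ, ‖T φ‖ ^ 2 ≤ b * ‖φ‖ ^ 2 := by
  choose T hT hlow hup using hF.exists_isWeakIntegral_univ
  have hT' : ∀ φ f, inner A f (T φ) = ∫ ω, φ ω * inner A f (F ω) ∂μ := fun φ f => by
    rw [(hT φ f).2, setIntegral_univ]
  have hint := hF.muComplete.1.integrable_mul
  let T₀ : L2 A μ →ₗ[ℂ] U :=
    { toFun := T
      map_add' := fun φ ψ => ext_inner A fun f => by
        rw [CStarModule.inner_add_right, hT', hT', hT', ← integral_add (hint φ f) (hint ψ f)]
        refine integral_congr_ae ?_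
        filter_upwards [L2.coeFn_add φ ψ] with ω h
        rw [h, add_mul]
      map_smul' := fun z φ => ext_inner A fun f => by
        rw [RingHom.id_apply, CStarModule.inner_smul_right_complex, hT', hT', ← integral_smul]
        refine integral_congr_ae ?_
        filter_upwards [L2.coeFn_smul_complex z φ] with ω h
        rw [h, smul_mul_assoc] }
  refine ⟨T₀.mkContinuous (√b) fun φ => ?_, hT, hlow, hup⟩
  refine (pow_le_pow_iff_left₀ (norm_nonneg _) (by positivity) two_ne_zero).1 ?_
  rw [mul_pow, Real.sq_sqrt hF.upper_pos.le]
  exact hup φ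

theorem IsBessel.exists_analysisOperator (h : IsBessel A μ F) :
    ∃ S : U →L[ℂ] L2 A μ, IsAnalysisOperator A μ F S := by
  let S (f : U) : L2 A μ := (h.memLp f).toLp _
  have hS : IsAnalysisOperator A μ F S := fun f => (h.memLp f).coeFn_toLp
  obtain ⟨B, hB0, hB⟩ := h.2
  let S₀ : U →ₗ[ℂ] L2 A μ :=
    { toFun := S
      map_add' := fun f g => by
        refine Lp.ext (E := A) ((hS (f + g)).trans (EventuallyEq.trans ?_
          (L2.coeFn_add (S f) (S g)).symm))
        filter_upwards [hS f, hS g] with ω hf hg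
        rw [hf, hg, CStarModule.inner_add_right]
      map_smul' := fun z f => by
        refine Lp.ext (E := A) ((hS (z • f)).trans (EventuallyEq.trans ?_
          (L2.coeFn_smul_complex z (S f)).symm))
        filter_upwards [hS f] with ω hf
        rw [hf, CStarModule.inner_smul_right_complex] }
  refine ⟨S₀.mkContinuous (√B) fun f => ?_, hS⟩
  refine (pow_le_pow_iff_left₀ (norm_nonneg _) (by positivity) two_ne_zero).1 ?_
  rw [mul_pow, Real.sq_sqrt hB0.le, L2.norm_sq, CStarModule.norm_sq_eq A (x := f)]
  have h1 : ∫ ω, S f ω * star (S f ω) ∂μ = ∫ ω, inner A (F ω) f * inner A f (F ω) ∂μ := by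
    refine integral_congr_ae ?_
    filter_upwards [hS f] with ω hf
    rw [hf, CStarModule.star_inner]
  change ‖∫ ω, S f ω * star (S f ω) ∂μ‖ ≤ _
  have h2 : 0 ≤ ∫ ω, S f ω * star (S f ω) ∂μ := integral_nonneg fun ω => mul_star_self_nonneg _
  calc _ ≤ ‖B • (inner A f f : A)‖ :=
        CStarAlgebra.norm_le_norm_of_nonneg_of_le h2 (h1.trans_le (hB f).2)
    _ = _ := by rw [norm_smul, Real.norm_of_nonneg hB0.le]

omit [StarOrderedRing A] in
theorem IsPreFrameOperator.isAdjoint {T : L2 A μ → U} {S : U → L2 A μ}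
    (hT : IsPreFrameOperator A μ F T) (hS : IsAnalysisOperator A μ F S) : IsAdjoint A T S :=
  fun φ f => by
    rw [(hT φ f).2, setIntegral_univ, L2.inner_def]
    refine integral_congr_ae ?_
    filter_upwards [hS f] with ω h
    rw [h, CStarModule.star_inner]

-- Evaluating `S (T φ)` at `γ` is testing the weak integral `T φ` against `f = F γ`.
omit [StarOrderedRing A] in
theorem IsPreFrameOperator.isGramMap {T : L2 A μ → U} {S : U → L2 A μ}
    (hT : IsPreFrameOperator A μ F T) (hS : IsAnalysisOperator A μ F S) :
    IsGramMap A μ F fun φ => S (T φ) := fun φ => by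
  refine ⟨fun γ => integrableOn_univ.1 (hT φ (F γ)).1, (hS (T φ)).trans ?_⟩
  filter_upwards with γ
  rw [(hT φ (F γ)).2, setIntegral_univ]

end Synthesis

end HilbertModule

/-! ### Assembly of the corollary. -/

theorem mainTheorem5 {Ω : Type*} [MeasurableSpace Ω] (μ : Measure Ω)
    {A : Type*} [CStarAlgebra A] [PartialOrder A] [StarOrderedRing A]
    {U : Type*} [NormedAddCommGroup U] [NormedSpace ℂ U] [Module A U] [CStarModule A U]
    [CompleteSpace U] (F : Ω → U) (a b : ℝ)
    (hF : HilbertModule.IsContinuousRieszBasis A μ F a b) :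
    HilbertModule.IsMuComplete A μ F ∧
    ∃ (T : HilbertModule.L2 A μ →L[ℂ] U) (S : U →L[ℂ] HilbertModule.L2 A μ)
      (V : HilbertModule.L2 A μ ≃L[ℂ] HilbertModule.L2 A μ),
      HilbertModule.IsPreFrameOperator A μ F T ∧
      HilbertModule.IsAnalysisOperator A μ F S ∧
      HilbertModule.IsAdjoint A T S ∧
      HilbertModule.IsGramMap A μ F V ∧
      (∀ φ, V φ = S (T φ)) ∧
      HilbertModule.IsAdjointable A V ∧
      HilbertModule.IsAdjointable A V.symm ∧
      ∀ φ : HilbertModule.L2 A μ,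
        ‖(V.symm : HilbertModule.L2 A μ →L[ℂ] HilbertModule.L2 A μ)‖⁻¹ • inner A φ φ
          ≤ inner A φ (V φ) ∧
        inner A φ (V φ) ≤ b • inner A φ φ := by
  obtain ⟨T, hT, hlow, hup⟩ := hF.exists_preFrameOperator
  obtain ⟨S, hS⟩ := hF.muComplete.1.exists_analysisOperator
  have hadj : HilbertModule.IsAdjoint A T S := hT.isAdjoint hS
  -- Injectivity of `S` is exactly the triviality condition in `μ`-completeness.
  have hinj : ∀ f, S f = 0 → f = 0 := fun f hf => by
    have h1 : f ∈ {f : U | ∀ᵐ ω ∂μ, inner A (F ω) f = 0} := by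
      have h0 : ((0 : HilbertModule.L2 A μ) : Ω → A) =ᵐ[μ] 0 := Lp.coeFn_zero A 2 μ
      have h2 := hS f
      rw [hf] at h2
      exact h2.symm.trans h0
    rw [hF.muComplete.2] at h1
    exact h1
  obtain ⟨V, hV⟩ := hadj.exists_equiv hF.lower_pos hlow hinj
  refine ⟨hF.muComplete, T, S, V, hT, hS, hadj, ?_, hV, ⟨V, hadj.isAdjoint_equiv hV⟩,
    ⟨V.symm, hadj.isAdjoint_equiv_symm hV⟩, fun φ => ⟨hadj.inv_norm_symm_smul_le hV φ,
    hadj.inner_map_self_le hV hF.upper_pos.le hup φ⟩⟩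
  rw [show (V : HilbertModule.L2 A μ → HilbertModule.L2 A μ) = fun φ => S (T φ) from funext hV]
  exact hT.isGramMap hS
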